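/- For vectors $C,E\in\mathbb{R}^2$ let $\angle(C,E)\in(-\pi,\pi]$ be the oriented angle from $C$ to $E$ (clockwise positive, equal to $\pi$ for opposite non-zero vectors, and $0$ if $C$ or $E$ is zero). For $A\neq B$ in $\mathbb{R}^2$ and $\psi\in(0,\pi)$ let $$\mathcal{S}(A,B,\psi)=\{C\in\mathbb{R}^2\setminus\{A,B\} : \angle(B-C,\,C-A)\in(-\psi,\psi)\},$$ and let $\mathcal{S}^{(n)}(A,B,\varphi)$ be the set of all sequences $(B^{(1)},\dots,B^{(n)})\in(\mathbb{R}^2)^n$ such that, with $B^{(0)}=A$ and $B^{(n+1)}=B$, $$\angle(B^{(i+1)}-B^{(i)},\,B^{(i)}-B^{(i-1)})\in[-\varphi,\varphi]\ \ (i=1,\dots,n),\qquad B^{(i)}\neq B^{(i+1)}\ \ (i=0,\dots,n).$$ Let $h_m(X,Y)\in[0,\infty]$ denote the Hausdorff distance of two sets with respect to the maximum norm on $\mathbb{R}^2$, respectively on $(\mathbb{R}^2)^n$ (with $h_m(X,\emptyset)=\infty$ for $X\neq\emptyset$). **Statement 5.10.** Let $\varphi\in(0,\pi)$, $n\geq 1$,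 $n\varphi<\pi$, and let $A,B\in\mathbb{R}^2$, $A\neq B$. Let $Q\subseteq\mathbb{R}^2$ be a convex set (not necessarily closed or bounded) with $\mathcal{S}(A,B,n\varphi)\cap Q\neq\emptyset$ and $\mathcal{S}^{(n)}(A,B,\varphi)\cap Q^n\neq\emptyset$; in the case $\varphi>\pi/2$ (which forces $n=1$) assume moreover that $A\in Q$ or $B\in Q$. For every $\tau>0$ let $Q^{(\tau)}\subseteq Q$ be a subset (for instance a finite or discrete one) with $h_m(Q^{(\tau)},Q)\leq\tau$. Then $$\lim_{\tau\to0^+}h_m\bigl(\mathcal{S}^{(n)}(A,B,\varphi)\cap Q^n,\ \mathcal{S}^{(n)}(A,B,\varphi)\cap[Q^{(\tau)}]^n\bigr)=0.$$ In particular, the second set is non-empty for all sufficiently small $\tau>0$. -/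

import Mathlib

namespace TurnPath

/-- The oriented angle from `C` to `E` in the plane, with values in `(-π, π]`, clockwise positive.
It is the argument of `c * conj e`, where `c = C.1 + C.2 i` and `e = E.1 + E.2 i`, whose real part
is `⟨C, E⟩` and whose imaginary part is `-det (C, E)`. It equals `π` for opposite nonzero vectors,
and it is `0` if one of the vectors vanishes (`Complex.arg 0 = 0`). -/
noncomputable def turnAngle (C E : ℝ × ℝ) : ℝ :=
  Complex.arg ⟨C.1 * E.1 + C.2 * E.2, C.2 * E.1 - C.1 * E.2⟩

/-- The set `S(A, B, ψ)` of the points `C ∉ {A, B}` with `∠(B - C, C - A) ∈ (-ψ, ψ)`. -/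
def lens (A B : ℝ × ℝ) (ψ : ℝ) : Set (ℝ × ℝ) :=
  {C | C ≠ A ∧ C ≠ B ∧ turnAngle (B - C) (C - A) ∈ Set.Ioo (-ψ) ψ}

/-- The vertices `B⁽⁰⁾ = A, B⁽¹⁾, …, B⁽ⁿ⁾, B⁽ⁿ⁺¹⁾ = B` of the polygonal line with interior vertices
`W = (B⁽¹⁾, …, B⁽ⁿ⁾)`; the indices above `n + 1` are not used. -/
noncomputable def vertex {n : ℕ} (A B : ℝ × ℝ) (W : Fin n → ℝ × ℝ) : ℕ → ℝ × ℝ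
  | 0 => A
  | k + 1 => if h : k < n then W ⟨k, h⟩ else B

/-- The set `S⁽ⁿ⁾(A, B, φ)` of the sequences `(B⁽¹⁾, …, B⁽ⁿ⁾)` of interior vertices of the polygonal
lines from `A` to `B` whose turn angles all lie in `[-φ, φ]` and whose consecutive vertices are
distinct. -/
def admissible (n : ℕ) (A B : ℝ × ℝ) (φ : ℝ) : Set (Fin n → ℝ × ℝ) :=
  {W | (∀ i : ℕ, 1 ≤ i → i ≤ n →
          turnAngle (vertex A B W (i + 1) - vertex A B W i)
            (vertex A B W i - vertex A B W (i - 1)) ∈ Set.Icc (-φ) φ) ∧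
        ∀ i : ℕ, i ≤ n → vertex A B W i ≠ vertex A B W (i + 1)}

/-- The Cartesian power `Qⁿ`. -/
def power (n : ℕ) (Q : Set (ℝ × ℝ)) : Set (Fin n → ℝ × ℝ) :=
  {W | ∀ i, W i ∈ Q}

end TurnPath

namespace TurnPath

open Filter Topology ComplexConjugate

/-! Lines whose turns all lie strictly inside `(-φ, φ)` form an open subset of the admissible set.
If they are dense in it relative to `Qⁿ`, then near every admissible line in `Qⁿ` there is a strict
one in `Qⁿ`, and moving its vertices slightly onto the discrete set keeps it admissible. The
admissible set is bounded because `n φ < π` puts all edges into a common cone of half-angle below `π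
/ 2`; so finitely many strict lines serve all admissible ones, and the approximation is uniform
(`tendsto_hausdorffEDist_of_isOpen`). The substance is density. For `n = 1` and `φ ≤ π / 2` the lens
is an intersection of two discs, and the vertex moves towards a point of its interior; for obtuse
`φ` it moves towards `A` or `B` (`admissible_one_subset_closure`). For `n ≥ 2`, where `φ < π / 2`,
all corners are cut at once: each vertex moves a little towards its two neighbours, with weights
such that every turn of size `φ` decreases to first order (`side_deriv_pos`,
`admissible_subset_closure`). -/

/-- The plane as `ℂ`. -/
noncomputable def toC : ℝ × ℝ →L[ℝ] ℂ := Complex.equivRealProdCLM.symm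

@[simp] lemma toC_re (P : ℝ × ℝ) : (toC P).re = P.1 := by simp [toC]

@[simp] lemma toC_im (P : ℝ × ℝ) : (toC P).im = P.2 := by simp [toC]

lemma toC_injective : Function.Injective toC := fun P R h => by
  have h1 := congrArg Complex.re h
  have h2 := congrArg Complex.im h
  simp only [toC_re, toC_im] at h1 h2
  exact Prod.ext h1 h2

lemma turnAngle_eq_arg (C E : ℝ × ℝ) : turnAngle C E = (toC C * conj (toC E)).arg := by
  unfold turnAngle
  congr 1
  apply Complex.ext
  · simp
  · simp
    ring

lemma norm_le_norm_toC (P : ℝ × ℝ) : ‖P‖ ≤ ‖toC P‖ := by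
  rw [Prod.norm_def, max_le_iff]
  constructor
  · simpa using Complex.abs_re_le_norm (toC P)
  · simpa using Complex.abs_im_le_norm (toC P)

/-! ### Sectors and their bounding lines. -/

/-- The open sector of half-angle `φ` around the positive real axis, without its apex. -/
def sector (φ : ℝ) : Set ℂ := {w | w ≠ 0 ∧ w.arg ∈ Set.Ioo (-φ) φ}

lemma isOpen_sector {φ : ℝ} (hφ : φ < Real.pi) : IsOpen (sector φ) := by
  have h : sector φ = Complex.slitPlane ∩ Complex.arg ⁻¹' Set.Ioo (-φ) φ := by
    ext w
    simp only [sector, Set.mem_ofPred_eq, Set.mem_inter_iff, Set.mem_preimage,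
      Complex.mem_slitPlane_iff_arg]
    constructor
    · rintro ⟨h0, h1⟩
      exact ⟨⟨(h1.2.trans hφ).ne, h0⟩, h1⟩
    · rintro ⟨⟨_, h0⟩, h1⟩
      exact ⟨h0, h1⟩
  rw [h]
  exact ContinuousOn.isOpen_inter_preimage
    (fun w hw => (Complex.continuousAt_arg hw).continuousWithinAt)
    Complex.isOpen_slitPlane isOpen_Ioo

/-- A positive multiple of the signed distance from `w` to the line of direction `exp (i φ)`. -/
noncomputable def side (φ : ℝ) (w : ℂ) : ℝ := Real.sin φ * w.re - Real.cos φ * w.im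

lemma side_eq_norm_mul_sin (φ : ℝ) (w : ℂ) : side φ w = ‖w‖ * Real.sin (φ - w.arg) := by
  have h1 := Complex.norm_mul_cos_arg w
  have h2 := Complex.norm_mul_sin_arg w
  rw [side, Real.sin_sub, ← h1, ← h2]
  ring

lemma side_conj_eq_norm_mul_sin (φ : ℝ) (w : ℂ) :
    side φ (conj w) = ‖w‖ * Real.sin (φ + w.arg) := by
  have h1 := Complex.norm_mul_cos_arg w
  have h2 := Complex.norm_mul_sin_arg w
  rw [side, Real.sin_add, Complex.conj_re, Complex.conj_im, ← h1, ← h2]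
  ring

@[fun_prop]
lemma continuous_side (φ : ℝ) : Continuous (side φ) := by
  unfold side
  fun_prop

/-- For `φ ≤ π / 2` the sector is an intersection of two half-planes. Adding the two inequalities
gives a positive real part, which confines the argument to a range where the signs of the sines
decide. -/
lemma mem_sector_of_side_pos {φ : ℝ} (h0 : 0 < φ) (h1 : φ ≤ Real.pi / 2) {w : ℂ}
    (hp : 0 < side φ w) (hm : 0 < side φ (conj w)) : w ∈ sector φ := by
  have hs : 0 < Real.sin φ := Real.sin_pos_of_pos_of_lt_pi h0 (by linarith [Real.pi_pos])
  have hre : 0 < w.re := by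
    simp only [side, Complex.conj_re, Complex.conj_im] at hp hm
    have : 0 < Real.sin φ * w.re := by linarith
    exact pos_of_mul_pos_right this hs.le
  have hw : w ≠ 0 := by
    rintro rfl
    simp at hre
  have harg := Complex.abs_arg_lt_pi_div_two_iff.2 (Or.inl hre)
  rw [abs_lt] at harg
  rw [side_eq_norm_mul_sin] at hp
  rw [side_conj_eq_norm_mul_sin] at hm
  refine ⟨hw, ?_, ?_⟩
  · by_contra! h
    have : Real.sin (φ + w.arg) ≤ 0 :=
      Real.sin_nonpos_of_nonpos_of_neg_pi_le (by linarith) (by linarith [Real.pi_pos])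
    exact absurd (mul_nonpos_of_nonneg_of_nonpos (norm_nonneg w) this) hm.not_ge
  · by_contra! h
    have : Real.sin (φ - w.arg) ≤ 0 :=
      Real.sin_nonpos_of_nonpos_of_neg_pi_le (by linarith) (by linarith [Real.pi_pos])
    exact absurd (mul_nonpos_of_nonneg_of_nonpos (norm_nonneg w) this) hp.not_ge

lemma side_nonneg_of_arg_mem {φ : ℝ} (h1 : φ ≤ Real.pi / 2) {w : ℂ}
    (hw : w.arg ∈ Set.Icc (-φ) φ) : 0 ≤ side φ w ∧ 0 ≤ side φ (conj w) := by
  rw [side_eq_norm_mul_sin, side_conj_eq_norm_mul_sin]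
  constructor <;> refine mul_nonneg (norm_nonneg _) (Real.sin_nonneg_of_nonneg_of_le_pi ?_ ?_) <;>
    linarith [hw.1, hw.2]

lemma abs_im_le_of_arg_mem {φ : ℝ} (h1 : φ ≤ Real.pi / 2) {w : ℂ}
    (hw : w.arg ∈ Set.Icc (-φ) φ) : |w.im| ≤ Real.sin φ * ‖w‖ := by
  have h2 : |Real.sin w.arg| ≤ Real.sin φ := by
    rw [abs_le, ← Real.sin_neg]
    exact ⟨Real.sin_le_sin_of_le_of_le_pi_div_two (by linarith) (by linarith [hw.2]) hw.1,
      Real.sin_le_sin_of_le_of_le_pi_div_two (by linarith [hw.1]) h1 hw.2⟩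
  rw [← Complex.norm_mul_sin_arg w, abs_mul, abs_of_nonneg (norm_nonneg w), mul_comm]
  exact mul_le_mul_of_nonneg_right h2 (norm_nonneg w)

/-! ### First-order effect of corner cutting on a single turn. -/

/-- If the turn from `e` to `c` is exactly `φ`, then replacing `c` by `c + t (a' f - m c + b e)` and
`e` by `e + t (a c - m' e + b' g)` decreases it to first order in `t`, as soon as the corner-cutting
weights `p`, `q` at the turn dominate those at its neighbours. -/
lemma side_deriv_pos {φ : ℝ} (hs : 0 < Real.sin φ) {c e f g : ℂ} (hc : c ≠ 0) (he : e ≠ 0)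
    (h0 : side φ (c * conj e) = 0) (h0' : 0 ≤ (c * conj e).im)
    {a b a' b' m m' p q p' q' : ℝ} (ha : a * ‖c‖ = p * ‖e‖) (hb : b * ‖e‖ = q * ‖c‖)
    (ha' : |a' * (f * conj c).im| ≤ Real.sin φ * (p' * ‖c‖ ^ 2))
    (hb' : |b' * (e * conj g).im| ≤ Real.sin φ * (q' * ‖e‖ ^ 2)) (hpq : p' + q' < p + q) :
    0 < side φ ((a' * f - m * c + b * e) * conj e + c * conj (a * c - m' * e + b' * g)) := by
  set r := ‖c‖ with hr
  set s := ‖e‖ with hse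
  have hr0 : 0 < r := norm_pos_iff.2 hc
  have hs0 : 0 < s := norm_pos_iff.2 he
  have hrr : c * conj c = ((r ^ 2 : ℝ) : ℂ) := by rw [Complex.mul_conj, Complex.normSq_eq_norm_sq]
  have hss : e * conj e = ((s ^ 2 : ℝ) : ℂ) := by rw [Complex.mul_conj, Complex.normSq_eq_norm_sq]
  -- That is, `c * conj e = r s exp (i φ)`; the sign of the imaginary part excludes the opposite
  -- ray.
  have hw : (c * conj e).re = r * s * Real.cos φ ∧ (c * conj e).im = r * s * Real.sin φ := by
    have hn : (c * conj e).re ^ 2 + (c * conj e).im ^ 2 = (r * s) ^ 2 := by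
      have h := Complex.normSq_eq_norm_sq (c * conj e)
      rw [norm_mul, Complex.norm_conj, Complex.normSq_apply] at h
      linarith
    generalize (c * conj e) = w at *
    have hcs := Real.sin_sq_add_cos_sq φ
    rw [side] at h0
    have h2 : Real.cos φ * w.re + Real.sin φ * w.im = r * s := by
      have hsl : Real.sin φ * (Real.cos φ * w.re + Real.sin φ * w.im) = w.im := by
        linear_combination Real.cos φ * h0 + w.im * hcs
      have hl : 0 ≤ Real.cos φ * w.re + Real.sin φ * w.im :=
        nonneg_of_mul_nonneg_right (by rw [hsl]; exact h0') hs
      refine (sq_eq_sq₀ hl (by positivity)).1 ?_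
      rw [← hn]
      linear_combination (w.re ^ 2 + w.im ^ 2) * hcs -
        (Real.sin φ * w.re - Real.cos φ * w.im) * h0
    rw [← h2]
    constructor
    · linear_combination Real.sin φ * h0 - w.re * hcs
    · linear_combination - Real.cos φ * h0 - w.im * hcs
  -- Rotation by `φ` carries the real axis to the line defining `side φ`. Hence the contributions of
  -- `f` and `g` are controlled by the neighbouring turns.
  have hrot : ∀ y : ℂ, side φ (y * (c * conj e)) = -(r * s * y.im) := by
    intro y
    rw [side, Complex.mul_re y, Complex.mul_im y, hw.1, hw.2]
    linear_combination -(r * s * y.im) * Real.sin_sq_add_cos_sq φ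
  have hreal : ∀ (y : ℂ) (k : ℝ), side φ ((k : ℂ) * y) = k * side φ y := by
    intro y k
    simp [side]
    ring
  have hX : r * side φ (f * conj e) = -(s * (f * conj c).im) := by
    refine mul_left_cancel₀ hr0.ne' ?_
    have h := hrot (f * conj c)
    rw [show f * conj c * (c * conj e) = (c * conj c) * (f * conj e) by ring, hrr, hreal] at h
    linear_combination h
  have hY : s * side φ (c * conj g) = -(r * (e * conj g).im) := by
    refine mul_left_cancel₀ hs0.ne' ?_
    have h := hrot (e * conj g)
    rw [show e * conj g * (c * conj e) = (e * conj e) * (c * conj g) by ring, hss, hreal] at h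
    linear_combination h
  have hX' : -(s * r * Real.sin φ * p') ≤ a' * side φ (f * conj e) := by
    have him : (a' * (f * conj c).im) ≤ Real.sin φ * (p' * r ^ 2) := (abs_le.1 ha').2
    refine le_of_mul_le_mul_left ?_ hr0
    calc r * -(s * r * Real.sin φ * p') = -(s * (Real.sin φ * (p' * r ^ 2))) := by ring
      _ ≤ -(s * (a' * (f * conj c).im)) := neg_le_neg (mul_le_mul_of_nonneg_left him hs0.le)
      _ = r * (a' * side φ (f * conj e)) := by linear_combination -a' * hX
  have hY' : -(s * r * Real.sin φ * q') ≤ b' * side φ (c * conj g) := by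
    have him : (b' * (e * conj g).im) ≤ Real.sin φ * (q' * s ^ 2) := (abs_le.1 hb').2
    refine le_of_mul_le_mul_left ?_ hs0
    calc s * -(s * r * Real.sin φ * q') = -(r * (Real.sin φ * (q' * s ^ 2))) := by ring
      _ ≤ -(r * (b' * (e * conj g).im)) := neg_le_neg (mul_le_mul_of_nonneg_left him hr0.le)
      _ = s * (b' * side φ (c * conj g)) := by linear_combination -b' * hY
  -- The multiples `m`, `m'` only rescale `c * conj e`, which lies on the line, so they drop out.
  -- The cut at this corner adds a positive real number.
  have hexp : side φ ((a' * f - m * c + b * e) * conj e + c * conj (a * c - m' * e + b' * g)) =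
      a' * side φ (f * conj e) + b' * side φ (c * conj g) + Real.sin φ * (b * s ^ 2 + a * r ^ 2) := by
    have h : (a' * f - m * c + b * e) * conj e + c * conj (a * c - m' * e + b' * g) =
        a' * (f * conj e) + b' * (c * conj g) + ((b * s ^ 2 + a * r ^ 2 : ℝ) : ℂ) -
          ((m + m' : ℝ) : ℂ) * (c * conj e) := by
      simp only [map_add, map_sub, map_mul, Complex.conj_ofReal]
      push_cast at hrr hss ⊢
      linear_combination b * hss + a * hrr
    have hadd : ∀ (y y' : ℂ), side φ (y + y') = side φ y + side φ y' := by
      intro y y'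
      simp only [side, Complex.add_re, Complex.add_im]
      ring
    have hsub : ∀ (y y' : ℂ), side φ (y - y') = side φ y - side φ y' := by
      intro y y'
      simp only [side, Complex.sub_re, Complex.sub_im]
      ring
    have hof : ∀ k : ℝ, side φ (k : ℂ) = Real.sin φ * k := by
      intro k
      simp [side]
    rw [h, hsub, hadd, hadd, hreal, hreal, hreal, hof, h0]
    ring
  rw [hexp]
  have hba : b * s ^ 2 + a * r ^ 2 = s * r * (p + q) := by
    linear_combination s * hb + r * ha
  have hpos : 0 < s * r * Real.sin φ * (p + q - p' - q') := by
    have : 0 < p + q - p' - q' := by linarith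
    positivity
  rw [hba]
  linarith

/-- The expression is a quadratic polynomial in `t`: continuity settles a positive constant term,
the linear term settles a vanishing one. -/
lemma eventually_side_pos {φ : ℝ} {c e d d' : ℂ} (h0 : 0 ≤ side φ (c * conj e))
    (h1 : side φ (c * conj e) = 0 → 0 < side φ (d * conj e + c * conj d')) :
    ∀ᶠ t : ℝ in 𝓝[>] 0, 0 < side φ ((c + t * d) * conj (e + t * d')) := by
  have key : ∀ t : ℝ, side φ ((c + t * d) * conj (e + t * d')) = side φ (c * conj e) +
      t * (side φ (d * conj e + c * conj d') + t * side φ (d * conj d')) := by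
    intro t
    simp [side]
    ring
  rcases h0.lt_or_eq with h | h
  · have : Tendsto (fun t : ℝ => side φ (c * conj e) +
        t * (side φ (d * conj e + c * conj d') + t * side φ (d * conj d'))) (𝓝[>] 0)
        (𝓝 (side φ (c * conj e) +
          0 * (side φ (d * conj e + c * conj d') + 0 * side φ (d * conj d')))) :=
      (Continuous.tendsto (by fun_prop) 0).mono_left nhdsWithin_le_nhds
    rw [zero_mul, add_zero] at this
    filter_upwards [this.eventually_const_lt h] with t ht
    rwa [key]
  · have : Tendsto (fun t : ℝ => side φ (d * conj e + c * conj d') + t * side φ (d * conj d'))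
        (𝓝[>] 0) (𝓝 (side φ (d * conj e + c * conj d') + 0 * side φ (d * conj d'))) :=
      (Continuous.tendsto (by fun_prop) 0).mono_left nhdsWithin_le_nhds
    rw [zero_mul, add_zero] at this
    filter_upwards [this.eventually_const_lt (h1 h.symm), self_mem_nhdsWithin] with t ht ht0
    rw [key, ← h, zero_add]
    exact mul_pos ht0 ht

/-! ### Polygonal lines, their edges, and openness of the strict condition. -/

variable {n : ℕ} {A B : ℝ × ℝ} {φ : ℝ}

@[simp] lemma vertex_zero (W : Fin n → ℝ × ℝ) : vertex A B W 0 = A := rfl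

lemma vertex_succ_of_lt (W : Fin n → ℝ × ℝ) {k : ℕ} (h : k < n) :
    vertex A B W (k + 1) = W ⟨k, h⟩ := by
  simp [vertex, h]

@[simp] lemma vertex_last (W : Fin n → ℝ × ℝ) : vertex A B W (n + 1) = B := by
  simp [vertex]

lemma continuous_vertex (A B : ℝ × ℝ) (k : ℕ) :
    Continuous fun W : Fin n → ℝ × ℝ => vertex A B W k := by
  cases k with
  | zero => exact continuous_const
  | succ k =>
    by_cases h : k < n
    · simpa only [vertex, h, dite_true] using continuous_apply (⟨k, h⟩ : Fin n)
    · simpa only [vertex, h, dite_false] using continuous_const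

/-- The edge vector from the vertex `i` to the vertex `i + 1`, as a complex number. -/
noncomputable def edge (A B : ℝ × ℝ) (W : Fin n → ℝ × ℝ) (i : ℕ) : ℂ :=
  toC (vertex A B W (i + 1) - vertex A B W i)

lemma continuous_edge (A B : ℝ × ℝ) (i : ℕ) :
    Continuous fun W : Fin n → ℝ × ℝ => edge A B W i :=
  toC.continuous.comp ((continuous_vertex A B (i + 1)).sub (continuous_vertex A B i))

lemma edge_ne_zero_iff (W : Fin n → ℝ × ℝ) (i : ℕ) :
    edge A B W i ≠ 0 ↔ vertex A B W i ≠ vertex A B W (i + 1) := by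
  rw [edge, ← map_zero toC, toC_injective.ne_iff, sub_ne_zero, ne_comm]

lemma mem_admissible_iff {W : Fin n → ℝ × ℝ} :
    W ∈ admissible n A B φ ↔
      (∀ i < n, (edge A B W (i + 1) * conj (edge A B W i)).arg ∈ Set.Icc (-φ) φ) ∧
        ∀ i ≤ n, edge A B W i ≠ 0 := by
  simp only [admissible, Set.mem_ofPred_eq, edge_ne_zero_iff, turnAngle_eq_arg]
  refine and_congr_left fun _ => ⟨fun h i hi => h (i + 1) (by omega) (by omega), ?_⟩
  intro h i h1 hi
  obtain ⟨k, rfl⟩ : ∃ k, i = k + 1 := ⟨i - 1, by omega⟩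
  exact h k (by omega)

/-- The interior vertices of the polygonal lines whose turn angles all lie in `(-φ, φ)` and whose
edges at turns do not vanish. -/
def strictlyAdmissible (n : ℕ) (A B : ℝ × ℝ) (φ : ℝ) : Set (Fin n → ℝ × ℝ) :=
  {W | ∀ i < n, edge A B W (i + 1) * conj (edge A B W i) ∈ sector φ}

lemma strictlyAdmissible_subset (hn : 1 ≤ n) :
    strictlyAdmissible n A B φ ⊆ admissible n A B φ := by
  intro W hW
  refine mem_admissible_iff.2 ⟨fun i hi => Set.Ioo_subset_Icc_self (hW i hi).2, fun i hi => ?_⟩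
  rcases hi.lt_or_eq with h | rfl
  · intro h0
    exact (hW i h).1 (by simp [h0])
  -- The last edge occurs only as the outgoing edge of the last turn, which exists since `1 ≤ n`.
  · obtain ⟨k, rfl⟩ : ∃ k, i = k + 1 := ⟨i - 1, by omega⟩
    exact left_ne_zero_of_mul (hW k (by omega)).1

lemma isOpen_strictlyAdmissible (hφ : φ < Real.pi) : IsOpen (strictlyAdmissible n A B φ) := by
  have h : strictlyAdmissible n A B φ = ⋂ i : Fin n,
      (fun W => edge A B W (i + 1) * conj (edge A B W i)) ⁻¹' sector φ := by
    ext W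
    simp only [strictlyAdmissible, Set.mem_ofPred_eq, Set.mem_iInter, Set.mem_preimage]
    exact ⟨fun h i => h i i.2, fun h i hi => h ⟨i, hi⟩⟩
  rw [h]
  exact isOpen_iInter_of_finite fun i => (isOpen_sector hφ).preimage
    ((continuous_edge A B _).mul (Complex.continuous_conj.comp (continuous_edge A B _)))

/-! ### Boundedness of the admissible set. -/

/-- Vectors each of which is turned by at most `φ` against the previous one lie in a common cone of
half-angle `n φ / 2`. -/
lemma exists_cone {z : ℕ → ℂ} (hφ : 0 ≤ φ) (hn : n * φ < Real.pi)
    (hz : ∀ i ≤ n, z i ≠ 0) (harg : ∀ i < n, (z (i + 1) * conj (z i)).arg ∈ Set.Icc (-φ) φ) :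
    ∃ u : ℂ, ‖u‖ = 1 ∧ ∀ i ≤ n, Real.cos (n * φ / 2) * ‖z i‖ ≤ (z i * u).re := by
  set α : ℕ → ℝ := fun i => (z (i + 1) * conj (z i)).arg with hα
  set s : ℕ → ℝ := fun i => ∑ j ∈ Finset.range i, α j with hs
  have hpolar : ∀ i ≤ n, z i = ‖z i‖ * Complex.exp (((z 0).arg + s i : ℝ) * Complex.I) := by
    intro i
    induction i with
    | zero =>
      intro _
      simp [hs, Complex.norm_mul_exp_arg_mul_I]
    | succ i ih =>
      intro hi
      have hzi := ih (by omega)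
      have hne := hz i (by omega)
      have h1 : ((‖z (i + 1) * conj (z i)‖ : ℝ) : ℂ) * Complex.exp (α i * Complex.I) =
          z (i + 1) * conj (z i) := Complex.norm_mul_exp_arg_mul_I _
      rw [norm_mul, Complex.norm_conj] at h1
      have h2 : conj (z i) * z i = ‖z i‖ * ‖z i‖ := by
        rw [mul_comm, Complex.mul_conj, Complex.normSq_eq_norm_sq]
        push_cast
        ring
      have h3 : ((‖z i‖ : ℝ) : ℂ) ≠ 0 := by simpa using hne
      have hsi : s (i + 1) = s i + α i := Finset.sum_range_succ _ _
      rw [hsi]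
      have hexp : Complex.exp (((z 0).arg + (s i + α i) : ℝ) * Complex.I) =
          Complex.exp (((z 0).arg + s i : ℝ) * Complex.I) * Complex.exp (α i * Complex.I) := by
        rw [← Complex.exp_add]
        congr 1
        push_cast
        ring
      rw [hexp]
      refine mul_left_cancel₀ (mul_ne_zero h3 h3) ?_
      push_cast at h1 hzi ⊢
      linear_combination -z i * h1 - z (i + 1) * h2 +
        ‖z (i + 1)‖ * ‖z i‖ * Complex.exp (α i * Complex.I) * hzi
  have hstep : ∀ i j, i + j ≤ n → |s (i + j) - s i| ≤ j * φ := by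
    intro i j
    induction j with
    | zero => simp
    | succ j ih =>
      intro hj
      have h1 := ih (by omega)
      have h2 : |α (i + j)| ≤ φ := abs_le.2 (harg (i + j) (by omega))
      have h3 : s (i + (j + 1)) = s (i + j) + α (i + j) := Finset.sum_range_succ _ _
      rw [h3]
      calc |s (i + j) + α (i + j) - s i| = |(s (i + j) - s i) + α (i + j)| := by ring_nf
        _ ≤ |s (i + j) - s i| + |α (i + j)| := abs_add_le _ _
        _ ≤ j * φ + φ := add_le_add h1 h2
        _ = (j + 1 : ℕ) * φ := by push_cast; ring
  -- The axis bisects the accumulated directions of the first and last vectors. As `s i - s n / 2`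
  -- is half of `s i - (s n - s i)`, the bounds `i φ` and `(n - i) φ` give `n φ / 2`.
  refine ⟨Complex.exp ((-((z 0).arg + s n / 2) : ℝ) * Complex.I),
    Complex.norm_exp_ofReal_mul_I _, fun i hi => ?_⟩
  have hre : (z i * Complex.exp ((-((z 0).arg + s n / 2) : ℝ) * Complex.I)).re =
      ‖z i‖ * Real.cos (s i - s n / 2) := by
    conv_lhs => rw [hpolar i hi]
    rw [mul_assoc, ← Complex.exp_add, Complex.re_ofReal_mul, ← Complex.exp_ofReal_mul_I_re]
    congr 3
    push_cast
    ring
  rw [hre, mul_comm]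
  refine mul_le_mul_of_nonneg_left ?_ (norm_nonneg _)
  rw [← Real.cos_abs (s i - s n / 2)]
  refine Real.cos_le_cos_of_nonneg_of_le_pi (abs_nonneg _) (by nlinarith) ?_
  have h1 := hstep 0 i (by omega)
  have h2 := hstep i (n - i) (by omega)
  have h0 : s 0 = 0 := by simp [hs]
  rw [zero_add, h0, sub_zero] at h1
  rw [Nat.add_sub_cancel' hi, Nat.cast_sub hi] at h2
  rw [abs_le] at h1 h2 ⊢
  constructor <;> nlinarith [h1.1, h1.2, h2.1, h2.2]

/-- Projected to the cone axis, the edges add up to the projection of `B - A`, and each keeps at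
least the fraction `cos (n φ / 2) > 0` of its length. This bounds the total length. -/
lemma isBounded_admissible (hφ : 0 ≤ φ) (hn : n * φ < Real.pi) (A B : ℝ × ℝ) :
    Bornology.IsBounded (admissible n A B φ) := by
  have hcos : 0 < Real.cos (n * φ / 2) := by
    have : 0 ≤ n * φ := by positivity
    exact Real.cos_pos_of_mem_Ioo ⟨by linarith [Real.pi_pos], by linarith⟩
  refine isBounded_iff_forall_norm_le.2
    ⟨‖A‖ + ‖toC (B - A)‖ / Real.cos (n * φ / 2), fun W hW => ?_⟩
  obtain ⟨harg, hz⟩ := mem_admissible_iff.1 hW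
  obtain ⟨u, hu, hcone⟩ := exists_cone hφ hn hz harg
  have htel : ∀ k, ∑ i ∈ Finset.range k, edge A B W i = toC (vertex A B W k - A) := by
    intro k
    simp only [edge]
    rw [← map_sum, Finset.sum_range_sub, vertex_zero]
  have hlen : ∑ i ∈ Finset.range (n + 1), ‖edge A B W i‖ ≤
      ‖toC (B - A)‖ / Real.cos (n * φ / 2) := by
    rw [le_div_iff₀ hcos, mul_comm, Finset.mul_sum]
    calc ∑ i ∈ Finset.range (n + 1), Real.cos (n * φ / 2) * ‖edge A B W i‖
        ≤ ∑ i ∈ Finset.range (n + 1), (edge A B W i * u).re :=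
          Finset.sum_le_sum fun i hi => hcone i (by simpa [Nat.lt_succ_iff] using hi)
      _ = (toC (B - A) * u).re := by
          rw [← Complex.re_sum, ← Finset.sum_mul, htel, vertex_last]
      _ ≤ ‖toC (B - A) * u‖ := Complex.re_le_norm _
      _ = ‖toC (B - A)‖ := by rw [norm_mul, hu, mul_one]
  refine (pi_norm_le_iff_of_nonneg (by positivity)).2 fun i => ?_
  have hWi : W i = A + (vertex A B W (i + 1) - A) := by
    rw [vertex_succ_of_lt W i.2]
    simp
  rw [hWi]
  refine (norm_add_le _ _).trans (add_le_add_right ?_ _)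
  calc ‖vertex A B W (i + 1) - A‖ ≤ ‖toC (vertex A B W (i + 1) - A)‖ := norm_le_norm_toC _
    _ ≤ ∑ j ∈ Finset.range (i + 1), ‖edge A B W j‖ := by
        rw [← htel]
        exact norm_sum_le _ _
    _ ≤ ∑ j ∈ Finset.range (n + 1), ‖edge A B W j‖ :=
        Finset.sum_le_sum_of_subset_of_nonneg (Finset.range_mono (by omega))
          fun _ _ _ => norm_nonneg _
    _ ≤ _ := hlen

/-! ### From density to Hausdorff convergence. -/

/-- If the points of `D` near which all points of `S` with coordinates in `Q` lie in `D` are dense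
in a bounded set, then finer and finer subsets of `Q` approximate that set. -/
lemma tendsto_hausdorffEDist_of_isOpen {S D : Set (Fin n → ℝ × ℝ)} {Q : Set (ℝ × ℝ)}
    (hS : Bornology.IsBounded S) (hD : IsOpen D) (hDS : D ⊆ S)
    (hdense : S ∩ power n Q ⊆ closure (D ∩ power n Q))
    {Qd : ℝ → Set (ℝ × ℝ)} (hQd : ∀ τ : ℝ, 0 < τ → Qd τ ⊆ Q)
    (hQdist : ∀ τ : ℝ, 0 < τ → Metric.hausdorffEDist (Qd τ) Q ≤ ENNReal.ofReal τ) :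
    Tendsto (fun τ : ℝ => Metric.hausdorffEDist (S ∩ power n Q) (S ∩ power n (Qd τ)))
      (𝓝[>] 0) (𝓝 0) := by
  refine ENNReal.tendsto_nhds_zero.2 fun ε hε => ?_
  -- One `r` each for passing to a point of `D`, then to a finite net, then to the discretized
  -- point.
  obtain ⟨r, hr0, hrε⟩ : ∃ r : ℝ, 0 < r ∧ ENNReal.ofReal (r + r + r) ≤ ε := by
    rcases eq_or_ne ε ⊤ with rfl | hε'
    · exact ⟨1, one_pos, le_top⟩
    · have := ENNReal.toReal_pos hε.ne' hε'
      refine ⟨ε.toReal / 3, by positivity, ?_⟩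
      rw [show ε.toReal / 3 + ε.toReal / 3 + ε.toReal / 3 = ε.toReal by ring,
        ENNReal.ofReal_toReal hε']
  have htb : TotallyBounded (D ∩ power n Q) :=
    (hS.isCompact_closure.totallyBounded.subset subset_closure).subset
      (Set.inter_subset_left.trans hDS)
  obtain ⟨N, hND, hNfin, hN⟩ := Metric.finite_approx_of_totallyBounded htb r hr0
  have hnear : ∀ V ∈ N, ∀ᶠ τ : ℝ in 𝓝[>] 0, ∃ V' ∈ S ∩ power n (Qd τ), dist V V' < r := by
    intro V hV
    obtain ⟨δ, hδ0, hδ⟩ := Metric.isOpen_iff.1 hD V (hND hV).1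
    filter_upwards [Ioo_mem_nhdsGT (lt_min hδ0 hr0)] with τ hτ
    have hclose : ∀ i, ∃ q ∈ Qd τ, dist (V i) q < min δ r := by
      intro i
      have hlt : Metric.hausdorffEDist Q (Qd τ) < ENNReal.ofReal (min δ r) := by
        rw [Metric.hausdorffEDist_comm]
        exact (hQdist τ hτ.1).trans_lt ((ENNReal.ofReal_lt_ofReal_iff (lt_min hδ0 hr0)).2 hτ.2)
      obtain ⟨q, hq, hdist⟩ := Metric.exists_edist_lt_of_hausdorffEDist_lt ((hND hV).2 i) hlt
      refine ⟨q, hq, ?_⟩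
      rwa [edist_dist, ENNReal.ofReal_lt_ofReal_iff (lt_min hδ0 hr0)] at hdist
    choose V' hV' hdist using hclose
    have hd : dist V V' < min δ r := (dist_pi_lt_iff (lt_min hδ0 hr0)).2 hdist
    refine ⟨V', ⟨hDS (hδ ?_), hV'⟩, hd.trans_le (min_le_right _ _)⟩
    rw [Metric.mem_ball, dist_comm]
    exact hd.trans_le (min_le_left _ _)
  filter_upwards [(eventually_all_finite hNfin).2 hnear, self_mem_nhdsWithin] with τ hτ hτ0
  refine (Metric.hausdorffEDist_le_of_mem_edist (fun W hW => ?_) fun W hW => ?_).trans hrε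
  · obtain ⟨U, hU, hWU⟩ := Metric.mem_closure_iff.1 (hdense hW) r hr0
    obtain ⟨V, hV, hUV⟩ := Set.mem_iUnion₂.1 (hN hU)
    obtain ⟨V', hV', hVV'⟩ := hτ V hV
    refine ⟨V', hV', ?_⟩
    rw [edist_dist]
    refine ENNReal.ofReal_le_ofReal ?_
    rw [Metric.mem_ball] at hUV
    linarith [dist_triangle4 W U V V']
  · exact ⟨W, ⟨hW.1, fun i => hQd τ hτ0 (hW.2 i)⟩, by simp⟩

/-! ### Density of strict lines with one interior vertex. -/

lemma side_pos_of_mem_sector (h1 : φ ≤ Real.pi / 2) {w : ℂ} (hw : w ∈ sector φ) :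
    0 < side φ w ∧ 0 < side φ (conj w) := by
  rw [side_eq_norm_mul_sin, side_conj_eq_norm_mul_sin]
  obtain ⟨h0, h2, h3⟩ := hw
  constructor <;> refine mul_pos (norm_pos_iff.2 h0) (Real.sin_pos_of_pos_of_lt_pi ?_ ?_) <;>
    linarith

/-- In the closed upper half-plane one bounding line suffices even for obtuse `φ`, and adding `s`
raises `side φ` by `s sin φ`. -/
lemma add_ofReal_mem_sector_of_im_nonneg (hφ : φ ∈ Set.Ioo 0 Real.pi) {w : ℂ} (him : 0 ≤ w.im)
    (harg : w.arg ≤ φ) {s : ℝ} (hs : 0 < s) : w + s ∈ sector φ := by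
  have h0 : 0 ≤ w.arg := Complex.arg_nonneg_iff.2 him
  have h0' : 0 ≤ (w + s).arg := Complex.arg_nonneg_iff.2 (by simpa using him)
  have h1 : 0 ≤ side φ w := by
    rw [side_eq_norm_mul_sin]
    exact mul_nonneg (norm_nonneg _)
      (Real.sin_nonneg_of_nonneg_of_le_pi (by linarith) (by linarith [hφ.2]))
  have h2 : 0 < side φ (w + s) := by
    have h3 := mul_pos (Real.sin_pos_of_pos_of_lt_pi hφ.1 hφ.2) hs
    refine (add_pos_of_nonneg_of_pos h1 h3).trans_eq ?_
    simp [side]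
    ring
  refine ⟨?_, by linarith [hφ.1], ?_⟩
  · intro h
    simp [h, side] at h2
  · by_contra! h
    rw [side_eq_norm_mul_sin] at h2
    have : Real.sin (φ - (w + s).arg) ≤ 0 :=
      Real.sin_nonpos_of_nonpos_of_neg_pi_le (by linarith)
        (by linarith [Complex.arg_le_pi (w + s), hφ.1])
    exact absurd (mul_nonpos_of_nonneg_of_nonpos (norm_nonneg _) this) h2.not_ge

/-- Adding a positive real number to a complex number decreases its argument in absolute value,
unless the argument is `0` or `π`. -/
lemma add_ofReal_mem_sector (hφ : φ ∈ Set.Ioo 0 Real.pi) {w : ℂ}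
    (harg : w.arg ∈ Set.Icc (-φ) φ) {s : ℝ} (hs : 0 < s) : w + s ∈ sector φ := by
  rcases le_or_gt 0 w.im with him | him
  · exact add_ofReal_mem_sector_of_im_nonneg hφ him harg.2 hs
  · have hneg : ∀ {z : ℂ}, z.im < 0 → (conj z).arg = -z.arg := by
      intro z hz
      rw [Complex.arg_conj, if_neg]
      linarith [Complex.arg_neg_iff.2 hz, Real.pi_pos]
    have h := add_ofReal_mem_sector_of_im_nonneg (w := conj w) hφ (by simpa using him.le)
      (by rw [hneg him]; linarith [harg.1]) hs
    rw [← Complex.conj_ofReal s, ← map_add] at h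
    obtain ⟨h1, h2, h3⟩ := h
    rw [hneg (by simpa using him)] at h2 h3
    exact ⟨(map_ne_zero _).1 h1, by linarith, by linarith⟩

lemma tendsto_nhdsGT_add_smul {E : Type*} [NormedAddCommGroup E] [NormedSpace ℝ E] (x y : E) :
    Tendsto (fun t : ℝ => x + t • y) (𝓝[>] 0) (𝓝 x) := by
  have : Tendsto (fun t : ℝ => x + t • y) (𝓝[>] 0) (𝓝 (x + (0 : ℝ) • y)) :=
    (Continuous.tendsto (by fun_prop) 0).mono_left nhdsWithin_le_nhds
  simpa using this

lemma edge_one_mul_conj_edge_zero (W : Fin 1 → ℝ × ℝ) :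
    edge A B W 1 * conj (edge A B W 0) = toC (B - W 0) * conj (toC (W 0 - A)) := by
  simp [edge, vertex]

/-- A one-vertex line is a limit of strict ones: its vertex can be moved towards a point of the open
lens, or towards `A` or `B` if `φ` is obtuse. -/
lemma admissible_one_subset_closure (hφ : φ ∈ Set.Ioo 0 Real.pi) {Q : Set (ℝ × ℝ)}
    (hQ : Convex ℝ Q) (hQlens : (lens A B φ ∩ Q).Nonempty)
    (hQAB : Real.pi / 2 < φ → A ∈ Q ∨ B ∈ Q) :
    admissible 1 A B φ ∩ power 1 Q ⊆ closure (strictlyAdmissible 1 A B φ ∩ power 1 Q) := by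
  rintro W ⟨hW, hWQ⟩
  obtain ⟨harg, hz⟩ := mem_admissible_iff.1 hW
  have hw0 : edge A B W 1 * conj (edge A B W 0) ≠ 0 :=
    mul_ne_zero (hz 1 le_rfl) ((map_ne_zero _).2 (hz 0 zero_le_one))
  have harg := harg 0 zero_lt_one
  rw [zero_add, edge_one_mul_conj_edge_zero] at harg
  rw [edge_one_mul_conj_edge_zero] at hw0
  obtain ⟨V, hVQ, hV⟩ : ∃ V ∈ Q, ∀ t : ℝ, 0 < t → t < 1 →
      toC (B - (W 0 + t • (V - W 0))) * conj (toC (W 0 + t • (V - W 0) - A)) ∈ sector φ := by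
    rcases le_or_gt φ (Real.pi / 2) with hφ2 | hφ2
    · obtain ⟨C, ⟨hCA, hCB, hC⟩, hCQ⟩ := hQlens
      refine ⟨C, hCQ, fun t ht0 ht1 => ?_⟩
      have hCs : toC (B - C) * conj (toC (C - A)) ∈ sector φ := by
        rw [turnAngle_eq_arg] at hC
        refine ⟨mul_ne_zero ?_ ((map_ne_zero _).2 ?_), hC⟩ <;>
          rw [← map_zero toC, toC_injective.ne_iff, sub_ne_zero]
        exacts [hCB.symm, hCA]
      have hC1 := side_pos_of_mem_sector hφ2 hCs
      have hW1 := side_nonneg_of_arg_mem hφ2 harg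
      have hs : 0 < Real.sin φ := Real.sin_pos_of_pos_of_lt_pi hφ.1 hφ.2
      -- The concavity gain: as a function of the vertex, each side is quadratic with leading part
      -- `-sin φ` times the squared norm.
      have h3 : 0 ≤ t * (1 - t) * (Real.sin φ * (((C - W 0).1) ^ 2 + ((C - W 0).2) ^ 2)) := by
        have : 0 ≤ 1 - t := by linarith
        positivity
      refine mem_sector_of_side_pos hφ.1 hφ2 ?_ ?_
      · have h1 := mul_nonneg (sub_nonneg.2 ht1.le) hW1.1
        have h2 := mul_pos ht0 hC1.1
        refine (add_pos_of_nonneg_of_pos (add_nonneg h3 h1) h2).trans_eq ?_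
        simp [side]
        ring
      · have h1 := mul_nonneg (sub_nonneg.2 ht1.le) hW1.2
        have h2 := mul_pos ht0 hC1.2
        refine (add_pos_of_nonneg_of_pos (add_nonneg h3 h1) h2).trans_eq ?_
        simp [side]
        ring
    -- Moving towards `A` or `B` scales one edge by `1 - t` and adds `t` times that edge to the
    -- other, so the product gains a positive real number up to scaling.
    · have hreal : ∀ {z w : ℂ} {t : ℝ}, 0 < t → t < 1 → z ≠ 0 →
          w.arg ∈ Set.Icc (-φ) φ → ((1 - t : ℝ) : ℂ) * (w + t * (z * conj z)) ∈ sector φ := by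
        intro z w t ht0 ht1 hz0 hw
        have h1 : (0 : ℝ) < 1 - t := by linarith
        have h2 := add_ofReal_mem_sector hφ hw (mul_pos ht0 (Complex.normSq_pos.2 hz0))
        rw [Complex.mul_conj, ← Complex.ofReal_mul]
        refine ⟨mul_ne_zero (by exact_mod_cast h1.ne') h2.1, ?_⟩
        rw [Complex.arg_real_mul _ h1]
        exact h2.2
      rcases hQAB hφ2 with hAQ | hBQ
      · refine ⟨A, hAQ, fun t ht0 ht1 => ?_⟩
        have := hreal ht0 ht1 ((map_ne_zero _).1 (right_ne_zero_of_mul hw0)) harg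
        convert this using 1
        simp only [map_sub, map_add, map_smul, Complex.real_smul, map_mul, Complex.conj_ofReal]
        push_cast
        ring
      · refine ⟨B, hBQ, fun t ht0 ht1 => ?_⟩
        have := hreal ht0 ht1 (left_ne_zero_of_mul hw0) harg
        convert this using 1
        simp only [map_sub, map_add, map_smul, Complex.real_smul, map_mul, Complex.conj_ofReal]
        push_cast
        ring
  refine mem_closure_of_tendsto
    (f := fun t : ℝ => W + t • (fun i => V - W i)) (tendsto_nhdsGT_add_smul _ _) ?_
  filter_upwards [Ioo_mem_nhdsGT (zero_lt_one' ℝ)] with t ht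
  refine ⟨fun i hi => ?_, fun i => ?_⟩
  · obtain rfl : i = 0 := by omega
    rw [zero_add, edge_one_mul_conj_edge_zero]
    exact hV t ht.1 ht.2
  · exact hQ.add_smul_sub_mem (hWQ i) hVQ ⟨ht.1.le, ht.2.le⟩

/-! ### Density for at least two interior vertices, by corner cutting. -/

/-- The zero-weight alternatives serve the first and last interior vertices, whose neighbours `A`
and `B` may lie outside `Q`. -/
lemma _root_.Convex.add_smul_add_smul_sub_mem {E : Type*} [AddCommGroup E] [Module ℝ E] {Q : Set E}
    (hQ : Convex ℝ Q) {x y z : E} (hx : x ∈ Q) {a b t : ℝ} (ha : 0 ≤ a) (hb : 0 ≤ b) (ht : 0 ≤ t)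
    (hab : t * (a + b) ≤ 1) (hy : a = 0 ∨ y ∈ Q) (hz : b = 0 ∨ z ∈ Q) :
    x + t • (a • (y - x) + b • (z - x)) ∈ Q := by
  wlog hy' : y ∈ Q generalizing y
  · obtain rfl : a = 0 := hy.resolve_right hy'
    simpa using this (y := x) (Or.inl rfl) hx
  wlog hz' : z ∈ Q generalizing z
  · obtain rfl : b = 0 := hz.resolve_right hz'
    simpa using this (z := x) (Or.inl rfl) hx
  have h : x + t • (a • (y - x) + b • (z - x)) =
      (1 - t * (a + b)) • x + (t * a) • y + (t * b) • z := by
    module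
  rw [h]
  have := hQ.sum_mem (t := Finset.univ) (w := ![1 - t * (a + b), t * a, t * b]) (z := ![x, y, z])
    (fun i _ => by
      fin_cases i
      exacts [sub_nonneg.2 hab, mul_nonneg ht ha, mul_nonneg ht hb])
    (by
      simp [Fin.sum_univ_three]
      ring)
    (fun i _ => by
      fin_cases i
      exacts [hx, hy', hz'])
  simpa [Fin.sum_univ_three] using this

/-- Corner cutting with weights `p`, `q` at a turn which dominate those at its neighbours makes the
turn strict. -/
lemma eventually_mul_conj_mem_sector (h0 : 0 < φ) (hφ2 : φ < Real.pi / 2) {c e f g : ℂ}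
    (hc : c ≠ 0) (he : e ≠ 0) (harg : (c * conj e).arg ∈ Set.Icc (-φ) φ)
    {a b a' b' m m' p q p' q' : ℝ} (ha : a * ‖c‖ = p * ‖e‖) (hb : b * ‖e‖ = q * ‖c‖)
    (ha' : |a' * (f * conj c).im| ≤ Real.sin φ * (p' * ‖c‖ ^ 2))
    (hb' : |b' * (e * conj g).im| ≤ Real.sin φ * (q' * ‖e‖ ^ 2)) (hpq : p' + q' < p + q) :
    ∀ᶠ t : ℝ in 𝓝[>] 0, (c + t * (a' * f - m * c + b * e)) *
      conj (e + t * (a * c - m' * e + b' * g)) ∈ sector φ := by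
  have hs : 0 < Real.sin φ := Real.sin_pos_of_pos_of_lt_pi h0 (by linarith)
  have hcos : 0 < Real.cos φ := Real.cos_pos_of_mem_Ioo ⟨by linarith, hφ2⟩
  have hw := side_nonneg_of_arg_mem hφ2.le harg
  have hsum : side φ (c * conj e) + side φ (conj (c * conj e)) =
      2 * Real.sin φ * (c * conj e).re := by
    simp only [side, Complex.conj_re, Complex.conj_im]
    ring
  have hre : 0 ≤ (c * conj e).re :=
    nonneg_of_mul_nonneg_right (by rw [← hsum]; exact add_nonneg hw.1 hw.2) (by positivity)
  have him : ∀ {w : ℂ}, 0 ≤ w.re → side φ w = 0 → 0 ≤ w.im := by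
    intro w hwre hw0
    refine nonneg_of_mul_nonneg_right ?_ hcos
    rw [side, sub_eq_zero] at hw0
    rw [← hw0]
    positivity
  have hev := eventually_side_pos (d := a' * f - m * c + b * e) (d' := a * c - m' * e + b' * g)
    hw.1 fun h => side_deriv_pos hs hc he h (him hre h) ha hb ha' hb' hpq
  rw [map_mul] at hw
  -- The bound `-φ` follows by reflecting the configuration.
  have hev' := eventually_side_pos (φ := φ) (c := conj c) (e := conj e)
    (d := a' * conj f - m * conj c + b * conj e) (d' := a * conj c - m' * conj e + b' * conj g)
    hw.2 fun h => side_deriv_pos hs ((map_ne_zero _).2 hc) ((map_ne_zero _).2 he) h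
      (him (by rwa [← map_mul, Complex.conj_re]) h) (by simpa using ha) (by simpa using hb)
      (by rw [← map_mul, Complex.conj_im, mul_neg, abs_neg, Complex.norm_conj]; exact ha')
      (by rw [← map_mul, Complex.conj_im, mul_neg, abs_neg, Complex.norm_conj]; exact hb') hpq
  filter_upwards [hev, hev'] with t ht ht'
  refine mem_sector_of_side_pos h0 hφ2.le ht ?_
  simpa only [map_mul, map_add, map_sub, Complex.conj_ofReal] using ht'

/-- A line with at least two vertices is a limit of strict ones with vertices in the convex hull of
the given ones: cutting the corners with suitable weights decreases every turn of size `φ`. -/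
lemma admissible_subset_closure (hn : 2 ≤ n) (hφ : 0 < φ) (hφ2 : φ < Real.pi / 2)
    {Q : Set (ℝ × ℝ)} (hQ : Convex ℝ Q) :
    admissible n A B φ ∩ power n Q ⊆ closure (strictlyAdmissible n A B φ ∩ power n Q) := by
  rintro W ⟨hW, hWQ⟩
  obtain ⟨harg, hz⟩ := mem_admissible_iff.1 hW
  set v := vertex A B W with hv
  set z := edge A B W with hzdef
  -- The sum `p i + q i` is `n - 1` at each interior vertex, while the competing neighbour weights
  -- `p (i + 1) + q (i - 1)` total at most `n - 2`. Moreover `q 1 = 0` and `p n = 0`, so no vertex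
  -- moves towards `A` or `B`.
  let p : ℕ → ℝ := fun i => if 1 ≤ i ∧ i ≤ n then n - i else 0
  let q : ℕ → ℝ := fun i => if 1 ≤ i ∧ i ≤ n then i - 1 else 0
  let a : ℕ → ℝ := fun i => p i * ‖z (i - 1)‖ / ‖z i‖
  let b : ℕ → ℝ := fun i => q i * ‖z i‖ / ‖z (i - 1)‖
  have hp0 : ∀ i, 0 ≤ p i := by
    intro i
    simp only [p]
    split_ifs with h
    · exact sub_nonneg.2 (by exact_mod_cast h.2)
    · exact le_rfl
  have hq0 : ∀ i, 0 ≤ q i := by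
    intro i
    simp only [q]
    split_ifs with h
    · exact sub_nonneg.2 (by exact_mod_cast h.1)
    · exact le_rfl
  have hpn : ∀ i, n ≤ i → p i = 0 := by
    intro i hi
    simp only [p]
    split_ifs with h
    · rw [le_antisymm hi h.2, sub_self]
    · rfl
  have hqn : ∀ i, n < i → q i = 0 := fun i hi => if_neg (by omega)
  have hq1 : ∀ i, i ≤ 1 → q i = 0 := by
    intro i hi
    simp only [q]
    split_ifs with h
    · rw [le_antisymm hi h.1, Nat.cast_one, sub_self]
    · rfl
  have hpz : p 0 = 0 := if_neg (by omega)
  have hz0 : ∀ i ≤ n, ‖z i‖ ≠ 0 := fun i hi => norm_ne_zero_iff.2 (hz i hi)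
  have ha : ∀ i, i + 1 ≤ n → a (i + 1) * ‖z (i + 1)‖ = p (i + 1) * ‖z i‖ := fun i hi =>
    div_mul_cancel₀ _ (hz0 _ hi)
  have hb : ∀ i, i ≤ n → b (i + 1) * ‖z i‖ = q (i + 1) * ‖z (i + 1)‖ := fun i hi =>
    div_mul_cancel₀ _ (hz0 i hi)
  have ha0 : ∀ i, 0 ≤ a i := fun i =>
    div_nonneg (mul_nonneg (hp0 i) (norm_nonneg _)) (norm_nonneg _)
  have hb0 : ∀ i, 0 ≤ b i := fun i =>
    div_nonneg (mul_nonneg (hq0 i) (norm_nonneg _)) (norm_nonneg _)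
  have hap : ∀ i, p i = 0 → a i = 0 := fun i h => by simp [a, h]
  have hbq : ∀ i, q i = 0 → b i = 0 := fun i h => by simp [b, h]
  have hpq : ∀ i < n, p (i + 2) + q i < p (i + 1) + q (i + 1) := by
    intro i hi
    have h1 : p (i + 1) = n - (i + 1 : ℕ) := if_pos (by omega)
    have h2 : q (i + 1) = (i + 1 : ℕ) - 1 := if_pos (by omega)
    have h2n : (2 : ℝ) ≤ n := by exact_mod_cast hn
    have h3 : p (i + 2) = 0 ∧ (i : ℝ) + 1 = n ∨ p (i + 2) = n - (i + 2 : ℕ) := by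
      rcases Nat.lt_or_ge (i + 1) n with h | h
      · exact Or.inr (if_pos (by omega))
      · refine Or.inl ⟨hpn _ (by omega), ?_⟩
        exact_mod_cast le_antisymm hi h
    have h4 : q i = 0 ∧ (i : ℝ) = 0 ∨ q i = i - 1 := by
      rcases Nat.eq_zero_or_pos i with rfl | h
      · exact Or.inl ⟨hq1 _ (by omega), by simp⟩
      · exact Or.inr (if_pos (by omega))
    push_cast at *
    rcases h3 with ⟨h3, h3'⟩ | h3 <;> rcases h4 with ⟨h4, h4'⟩ | h4 <;> linarith
  let D : ℕ → ℝ × ℝ := fun k => a k • (v (k + 1) - v k) + b k • (v (k - 1) - v k)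
  have hvt : ∀ t : ℝ, ∀ k ≤ n + 1,
      vertex A B (W + t • fun i : Fin n => D (i + 1)) k = v k + t • D k := by
    intro t k hk
    rcases k with _ | k
    -- The endpoints stay fixed: their weights vanish, so the truncated index `0 - 1` is harmless.
    · simp [D, hap 0 hpz, hbq 0 (hq1 0 (by omega)), hv]
    · rcases Nat.lt_or_ge k n with h | h
      · rw [vertex_succ_of_lt _ h, hv, vertex_succ_of_lt _ h]
        rfl
      · obtain rfl : k = n := by omega
        simp [D, hap _ (hpn (k + 1) (by omega)), hbq _ (hqn (k + 1) (by omega)), hv]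
  have hD : ∀ k, toC (D k) = a k * z k - b k * z (k - 1) := by
    intro k
    have h : b k * toC (v (k - 1) - v k) = -(b k * z (k - 1)) := by
      rcases k with _ | k
      · simp [hbq 0 (hq1 0 (by omega))]
      · rw [← neg_sub, map_neg, mul_neg]
        rfl
    simp only [D, map_add, map_smul, Complex.real_smul]
    rw [h, ← sub_eq_add_neg]
    rfl
  have hzt : ∀ t : ℝ, ∀ k ≤ n, edge A B (W + t • fun i : Fin n => D (i + 1)) k =
      z k + t * (a (k + 1) * z (k + 1) - (b (k + 1) + a k : ℝ) * z k + b k * z (k - 1)) := by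
    intro t k hk
    have h : z k = toC (v (k + 1)) - toC (v k) := map_sub _ _ _
    rw [edge, hvt t _ (by omega), hvt t _ (by omega)]
    simp only [map_sub, map_add, map_smul, Complex.real_smul, hD, Nat.add_sub_cancel]
    push_cast
    linear_combination -h
  have hturn : ∀ i < n, ∀ᶠ t : ℝ in 𝓝[>] 0,
      edge A B (W + t • fun i : Fin n => D (i + 1)) (i + 1) *
        conj (edge A B (W + t • fun i : Fin n => D (i + 1)) i) ∈ sector φ := by
    intro i hi
    have him : ∀ j < n, |(z (j + 1) * conj (z j)).im| ≤ Real.sin φ * (‖z (j + 1)‖ * ‖z j‖) := by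
      intro j hj
      simpa using abs_im_le_of_arg_mem hφ2.le (harg j hj)
    refine (eventually_mul_conj_mem_sector hφ hφ2 (hz (i + 1) hi) (hz i hi.le) (harg i hi)
      (f := z (i + 2)) (g := z (i - 1)) (m := b (i + 2) + a (i + 1)) (m' := b (i + 1) + a i)
      (ha i hi) (hb i hi.le) (a' := a (i + 2)) (b' := b i) ?_ ?_ (hpq i hi)).mono
      fun t ht => ?_
    · rcases Nat.lt_or_ge (i + 1) n with h | h
      · rw [abs_mul, abs_of_nonneg (ha0 _)]
        refine (mul_le_mul_of_nonneg_left (him (i + 1) h) (ha0 _)).trans_eq ?_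
        linear_combination Real.sin φ * ‖z (i + 1)‖ * ha (i + 1) h
      · simp [hap _ (hpn (i + 2) (by omega)), hpn (i + 2) (by omega)]
    · rcases i with _ | i
      · simp [hbq 0 (hq1 0 (by omega)), hq1 0 (by omega)]
      · rw [abs_mul, abs_of_nonneg (hb0 _), Nat.add_sub_cancel]
        refine (mul_le_mul_of_nonneg_left (him i (by omega)) (hb0 _)).trans_eq ?_
        linear_combination Real.sin φ * ‖z (i + 1)‖ * hb i (by omega)
    · rw [hzt t (i + 1) hi, hzt t i hi.le]
      exact ht
  have hsmall : ∀ i : ℕ, ∀ᶠ t : ℝ in 𝓝[>] 0, t * (a i + b i) ≤ 1 := by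
    intro i
    have h : Tendsto (fun t : ℝ => t * (a i + b i)) (𝓝[>] 0) (𝓝 (0 * (a i + b i))) :=
      (Continuous.tendsto (by fun_prop) 0).mono_left nhdsWithin_le_nhds
    rw [zero_mul] at h
    exact (h.eventually_lt_const one_pos).mono fun _ => le_of_lt
  refine mem_closure_of_tendsto (f := fun t : ℝ => W + t • fun i : Fin n => D (i + 1))
    (tendsto_nhdsGT_add_smul _ _) ?_
  have h1 := (eventually_all_finset (Finset.range n)).2 fun i hi =>
    hturn i (Finset.mem_range.1 hi)
  have h2 := eventually_all.2 fun i : Fin n => hsmall (i + 1)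
  filter_upwards [h1, h2, self_mem_nhdsWithin] with t ht1 ht2 ht0
  refine ⟨fun i hi => ht1 i (Finset.mem_range.2 hi), fun i => ?_⟩
  have hWi : v (i + 1) = W i := vertex_succ_of_lt W i.2
  have hmem : v (i + 1) + t • D (i + 1) ∈ Q := by
    refine hQ.add_smul_add_smul_sub_mem (hWi ▸ hWQ i) (ha0 _) (hb0 _) (le_of_lt ht0) (ht2 i)
      ?_ ?_
    · rcases Nat.lt_or_ge (i + 1) n with h | h
      · right
        rw [hv, vertex_succ_of_lt W h]
        exact hWQ _
      · exact Or.inl (hap _ (hpn _ h))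
    · obtain ⟨i, hi⟩ := i
      rcases i with _ | i
      · exact Or.inl (hbq _ (hq1 _ le_rfl))
      · right
        simp only [Nat.add_sub_cancel]
        rw [hv, vertex_succ_of_lt W (by omega : i < n)]
        exact hWQ _
  rw [hWi] at hmem
  exact hmem

end TurnPath

theorem mainTheorem6 (n : ℕ) (hn : 1 ≤ n) (φ : ℝ) (hφ : φ ∈ Set.Ioo 0 Real.pi)
    (hnφ : (n : ℝ) * φ < Real.pi) (A B : ℝ × ℝ) (hAB : A ≠ B)
    (Q : Set (ℝ × ℝ)) (hQ : Convex ℝ Q)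
    (hQlens : (TurnPath.lens A B ((n : ℝ) * φ) ∩ Q).Nonempty)
    (hQadm : (TurnPath.admissible n A B φ ∩ TurnPath.power n Q).Nonempty)
    (hQAB : Real.pi / 2 < φ → A ∈ Q ∨ B ∈ Q)
    (Qd : ℝ → Set (ℝ × ℝ)) (hQd : ∀ τ : ℝ, 0 < τ → Qd τ ⊆ Q)
    (hQdist : ∀ τ : ℝ, 0 < τ → Metric.hausdorffEDist (Qd τ) Q ≤ ENNReal.ofReal τ) :
    Filter.Tendsto
      (fun τ : ℝ => Metric.hausdorffEDist
        (TurnPath.admissible n A B φ ∩ TurnPath.power n Q)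
        (TurnPath.admissible n A B φ ∩ TurnPath.power n (Qd τ)))
      (nhdsWithin 0 (Set.Ioi 0)) (nhds 0) := by
  refine TurnPath.tendsto_hausdorffEDist_of_isOpen
    (TurnPath.isBounded_admissible hφ.1.le hnφ A B) (TurnPath.isOpen_strictlyAdmissible hφ.2)
    (TurnPath.strictlyAdmissible_subset hn) ?_ hQd hQdist
  rcases hn.eq_or_lt with rfl | hn2
  · refine TurnPath.admissible_one_subset_closure hφ hQ ?_ hQAB
    simpa using hQlens
  -- With `2 ≤ n`, the bound `n φ < π` forces `φ < π / 2`.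
  · have h2 : (2 : ℝ) ≤ n := by exact_mod_cast hn2
    exact TurnPath.admissible_subset_closure hn2 hφ.1 (by nlinarith [hφ.1]) hQ
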